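/- Let $m,n\ge 0$ be integers. A rooted plane tree is either a leaf or a node with a non-empty ordered list of children; leaves are not nodes. A \emph{cut} of a tree is a set of nodes containing precisely one node on the path from the root to each leaf. A \emph{binary $m$-painted $n$-tree} $\mathbb{T}=(T,C,\mu)$ consists of a tree $T$ with $n+1$ leaves, a sequence $C=(C_1,\dots,C_m)$ of cuts of $T$ such that each node of $C_{k+1}$ lies on the path from the root to a node of $C_k$ and is not in $C_k$, and such that all nodes in $\bigcup_k C_k$ have exactly one child while all other nodes have exactly two children, and a bijective labeling $\mu$ of the $m$ cuts by $[m]$. The $n$ binary nodes are labeled by $1,\dots,n$ in inorder. Trees are drawn with the root at the top, so that \emph{below} means on the side of the leaves: a binary node is below a cut if it is a descendant of a node of the cut, a cut is below a binary node if it contains a descendant of this node, and a cut $C_k$ is weakly below a cut $C_l$ if each node of $C_k$ is equal to or a descendant of a node of $C_l$. Let $\preccurlyeq_{\mathbb{T}}$ be the preorder on $[m+n]$ generated by the relations $i\preccurlyeq j$ whenever some node carrying $i$ is equal to or a descendant of some node carrying $j$, where $i\le m$ is carried by the nodes of the cut labeled $i$, and $i\ge m+1$ is carried by the binary node with inorder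 label $i-m$. Let $\mathrm{Perm}(m)\subset\mathbb{R}^m$ be the convex hull of the points $\sum_{i} i\,\boldsymbol{e}_{\sigma(i)}$ over all permutations $\sigma$ of $[m]$. Let $\mathrm{Asso}(n)\subset\mathbb{R}^n$ be the convex hull of the points $\sum_i \ell(B,i)\,r(B,i)\,\boldsymbol{e}_i$ over all binary trees $B$ with $n+1$ leaves, where $\ell(B,i)$ and $r(B,i)$ are the numbers of leaves in the left and right subtrees of the $i$-th node of $B$ in inorder. The $(m,n)$-multiplihedron is the Minkowski sum \[ \mathrm{Mul}(m,n)=\big(\mathrm{Perm}(m)\times\mathrm{Asso}(n)\big)+\sum_{i\in[m],\,j\in[n]}[\boldsymbol{e}_i,\boldsymbol{e}_{m+j}]\subset\mathbb{R}^{m+n}. \] Then for every binary $m$-painted $n$-tree $\mathbb{T}$, there is a unique vertex $\boldsymbol{v}$ of $\mathrm{Mul}(m,n)$ corresponding to $\mathbb{T}$, that is, whose normal cone $\{\boldsymbol{x} : \langle\boldsymbol{x},\boldsymbol{p}\rangle\le\langle\boldsymbol{x},\boldsymbol{v}\rangle \text{ for all } \boldsymbol{p}\in\mathrm{Mul}(m,n)\}$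 is $\{\boldsymbol{x}\in\mathbb{R}^{m+n} : x_i\le x_j \text{ whenever } i\preccurlyeq_{\mathbb{T}} j\}$. For $i\in[m+n]$, its $i$-th coordinate is given by \begin{itemize} \item if $i\le m$, the number of binary nodes below the cut labeled by $i$, plus the number of cuts weakly below this cut (including itself), \item if $i\ge m+1$, the number of cuts below $\boldsymbol{n}$ plus the product of the numbers of leaves in the left and right subtrees of $\boldsymbol{n}$, where $\boldsymbol{n}$ is the binary node labeled by $i-m$ in inorder. \end{itemize} In particular, the sum of the coordinates is $\binom{m+1}{2}+\binom{n+1}{2}+mn$. -/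

import Mathlib

open scoped Pointwise

/-- Rooted plane trees all of whose nodes have one or two children. A leaf is not a node. -/
inductive PTree : Type
  | leaf : PTree
  | unary (t : PTree) : PTree
  | binary (l r : PTree) : PTree

namespace PTree

/-- The number of leaves. -/
def numLeaves : PTree → ℕ
  | leaf => 1
  | unary t => t.numLeaves
  | binary l r => l.numLeaves + r.numLeaves

/-- The subtree at an address. An address is the list of directions followed from the root: `false`
goes to the only child of a unary node or to the left child of a binary node, `true` goes to the
right child of a binary node. The root has address `[]`. The value is `none` if the address does not
exist in the tree. -/
def subtree : PTree → List Bool → Option PTree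
  | t, [] => some t
  | unary t, false :: p => t.subtree p
  | binary l _, false :: p => l.subtree p
  | binary _ r, true :: p => r.subtree p
  | _, _ => none

/-- `p` is the address of a leaf. -/
def IsLeafAt (T : PTree) (p : List Bool) : Prop := T.subtree p = some leaf

/-- `p` is the address of a node of degree one. -/
def IsUnaryAt (T : PTree) (p : List Bool) : Prop := ∃ t, T.subtree p = some (unary t)

/-- `p` is the address of a node of degree two. -/
def IsBinaryAt (T : PTree) (p : List Bool) : Prop := ∃ l r, T.subtree p = some (binary l r)

/-- `p` is the address of a node. -/
def IsNodeAt (T : PTree) (p : List Bool) : Prop := T.IsUnaryAt p ∨ T.IsBinaryAt p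

/-- The number of leaves in the left subtree of the binary node at `p`. -/
def leftLeaves (T : PTree) (p : List Bool) : ℕ :=
  match T.subtree p with
  | some (binary l _) => l.numLeaves
  | _ => 0

/-- The number of leaves in the right subtree of the binary node at `p`. -/
def rightLeaves (T : PTree) (p : List Bool) : ℕ :=
  match T.subtree p with
  | some (binary _ r) => r.numLeaves
  | _ => 0

/-- The addresses of the binary nodes, listed in inorder. -/
def inorder : PTree → List (List Bool)
  | leaf => []
  | unary t => t.inorder.map (List.cons false)
  | binary l r => l.inorder.map (List.cons false) ++ [] :: r.inorder.map (List.cons true)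

theorem length_inorder (T : PTree) : T.inorder.length + 1 = T.numLeaves := by
  induction T with
  | leaf => rfl
  | unary t ih => simpa [inorder, numLeaves] using ih
  | binary l r ihl ihr => simp [inorder, numLeaves]; omega

/-- The binary node with inorder label `j + 1`, for `j = 0, …, n - 1`, of a tree with `n + 1`
leaves. -/
def inorderNode {n : ℕ} (T : PTree) (hT : T.numLeaves = n + 1) (j : Fin n) : List Bool :=
  T.inorder[j.val]'(by have := T.length_inorder; omega)

/-- A cut: a set of nodes that contains precisely one node along the path from the root to any
leaf. The nodes along this path are the prefixes of the address of the leaf. -/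
def IsCut (T : PTree) (C : Set (List Bool)) : Prop :=
  (∀ p ∈ C, T.IsNodeAt p) ∧ ∀ q, T.IsLeafAt q → ∃! p, p ∈ C ∧ p <+: q

/-- The stump of a cut: all nodes on a path from the root to a node of the cut. -/
def stump (T : PTree) (C : Set (List Bool)) : Set (List Bool) :=
  {p | T.IsNodeAt p ∧ ∃ q ∈ C, p <+: q}

end PTree

/-- The permutahedron in `ℝⁿ`: the convex hull of the points `∑ i, i • e_{σ i}`. -/
def permutahedron (n : ℕ) : Set (Fin n → ℝ) :=
  convexHull ℝ (Set.range fun σ : Equiv.Perm (Fin n) =>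
    ∑ i : Fin n, ((i.val : ℝ) + 1) • (Pi.single (σ i) 1 : Fin n → ℝ))

/-- The associahedron in `ℝⁿ`: the convex hull of the points `∑ i, ℓ(T,i) r(T,i) • e_i` for all
binary trees `T` with `n + 1` leaves. -/
def associahedron (n : ℕ) : Set (Fin n → ℝ) :=
  convexHull ℝ {x | ∃ (T : PTree) (hT : T.numLeaves = n + 1), (∀ p, ¬ T.IsUnaryAt p) ∧
    x = fun i => (T.leftLeaves (T.inorderNode hT i) : ℝ) * T.rightLeaves (T.inorderNode hT i)}

/-- The shuffle `(P × Q) + ∑ i j, [e_i, e_{m+j}]`, with Minkowski sums. -/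
def shuffle {m n : ℕ} (P : Set (Fin m → ℝ)) (Q : Set (Fin n → ℝ)) : Set (Fin (m + n) → ℝ) :=
  {x | ∃ p ∈ P, ∃ q ∈ Q, x = Fin.append p q} +
    ∑ i : Fin m, ∑ j : Fin n,
      segment ℝ (Pi.single (Fin.castAdd n i) 1 : Fin (m + n) → ℝ) (Pi.single (Fin.natAdd m j) 1)

/-- The `(m,n)`-multiplihedron. -/
def multiplihedron (m n : ℕ) : Set (Fin (m + n) → ℝ) :=
  shuffle (permutahedron m) (associahedron n)

/-- The normal cone of a face `F` of a polytope `P`: the linear functions maximized over `P` by all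
of `F`. -/
def normalCone {ι : Type} [Fintype ι] (P F : Set (ι → ℝ)) : Set (ι → ℝ) :=
  {x | ∀ f ∈ F, ∀ p ∈ P, x ⬝ᵥ p ≤ x ⬝ᵥ f}

/-- A binary `m`-painted `n`-tree: a tree with `n + 1` leaves, a sequence of `m` cuts, each one
strictly closer to the root than the previous one, such that the nodes in the cuts have degree one
and the other nodes have degree two, and an ordered partition of the `m` labels into `m` parts,
that is, a bijection giving the label of each cut. -/
structure BinaryPaintedTree (m n : ℕ) where
  tree : PTree
  numLeaves_tree : tree.numLeaves = n + 1
  cut : Fin m → Set (List Bool)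
  isCut : ∀ k, tree.IsCut (cut k)
  cut_subset : ∀ k l : Fin m, k.val + 1 = l.val → cut l ⊆ tree.stump (cut k) \ cut k
  unary_of_mem : ∀ p, tree.IsNodeAt p → (∃ k, p ∈ cut k) → tree.IsUnaryAt p
  binary_of_notMem : ∀ p, tree.IsNodeAt p → (¬ ∃ k, p ∈ cut k) → tree.IsBinaryAt p
  label : Fin m ≃ Fin m

namespace BinaryPaintedTree

variable {m n : ℕ}

/-- The cut labeled by `a`. -/
def cutLabeled (PT : BinaryPaintedTree m n) (a : Fin m) : Set (List Bool) :=
  PT.cut (PT.label.symm a)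

/-- The binary node labeled by `j` in inorder. -/
def node (PT : BinaryPaintedTree m n) (j : Fin n) : List Bool :=
  PT.tree.inorderNode PT.numLeaves_tree j

/-- The set of nodes whose label contains `i`: the cut labeled by `i` if `i` is among the first `m`
indices, and otherwise the binary node whose inorder label, shifted by `m`, is `i`. -/
def nodesLabeled (PT : BinaryPaintedTree m n) (i : Fin (m + n)) : Set (List Bool) :=
  Fin.addCases (motive := fun _ => Set (List Bool))
    (fun a => PT.cutLabeled a) (fun j => {PT.node j}) i

/-- The preposet of `PT`, generated by the relations `i ≼ j` for which there is a path, oriented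
towards the root, from a node whose label contains `i` to a node whose label contains `j`. -/
def preposet (PT : BinaryPaintedTree m n) : Fin (m + n) → Fin (m + n) → Prop :=
  Relation.ReflTransGen fun i j =>
    ∃ p ∈ PT.nodesLabeled i, ∃ q ∈ PT.nodesLabeled j, q <+: p

/-- The cone of `PT`. -/
def cone (PT : BinaryPaintedTree m n) : Set (Fin (m + n) → ℝ) :=
  {x | ∀ i j, PT.preposet i j → x i ≤ x j}

/-- `v` is the vertex of the multiplihedron that corresponds to `PT`: it is a vertex
(a zero-dimensional face) and its normal cone is the cone of `PT`. -/
def IsCorrespondingVertex (PT : BinaryPaintedTree m n) (v : Fin (m + n) → ℝ) : Prop :=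
  v ∈ (multiplihedron m n).exposedPoints ℝ ∧ normalCone (multiplihedron m n) {v} = PT.cone

/-- The number of binary nodes below the cut labeled by `a`, that is, on the side of the leaves. -/
noncomputable def numNodesBelowCut (PT : BinaryPaintedTree m n) (a : Fin m) : ℕ :=
  {p | PT.tree.IsBinaryAt p ∧ ∃ q ∈ PT.cutLabeled a, q <+: p}.ncard

/-- The number of cuts weakly below the cut labeled by `a` (this cut included). -/
noncomputable def numCutsBelowCut (PT : BinaryPaintedTree m n) (a : Fin m) : ℕ :=
  {b : Fin m | ∀ p ∈ PT.cutLabeled b, ∃ q ∈ PT.cutLabeled a, q <+: p}.ncard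

/-- The number of cuts below the node `p`, that is, of cuts that contain a descendant of `p`. -/
noncomputable def numCutsBelowNode (PT : BinaryPaintedTree m n) (p : List Bool) : ℕ :=
  {b : Fin m | ∃ q ∈ PT.cutLabeled b, p <+: q}.ncard

end BinaryPaintedTree

/-!
A linear function is maximal over a Minkowski sum at a sum of points if and only if it is maximal
over each summand at the corresponding point, so the normal cone at the sum is the intersection of
the normal cones of the summands. For the vertex of a painted tree these are the following.

* The permutahedron contributes the order of the cuts, by the rearrangement inequality.
* The segment of a cut and a binary node contributes their comparison.
* The associahedron contributes the order of the binary nodes. In a binary tree, every non-empty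
  interval of `[n]` contains exactly one node that is an ancestor of all nodes of the interval, and
  the node `i` plays this role for `ℓ(B,i) r(B,i)` intervals. Hence the scalar product of `x` with
  the point of the tree is at most the sum of the maxima of `x` over all intervals, with equality if
  and only if `x` weakly decreases away from the root. Every `x` has such a tree, so this sum is the
  maximum of `x` over the associahedron.

Together these comparisons generate the preposet of the painted tree. Since the preposet is
antisymmetric, its cone has an interior point; the point is therefore exposed, and no other point
has the same normal cone.
-/

section NormalCone

variable {ι : Type} [Fintype ι]

theorem mem_normalCone_singleton {P : Set (ι → ℝ)} {v x : ι → ℝ} :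
    x ∈ normalCone P {v} ↔ ∀ p ∈ P, x ⬝ᵥ p ≤ x ⬝ᵥ v := by
  simp [normalCone]

theorem normalCone_convexHull (S F : Set (ι → ℝ)) :
    normalCone (convexHull ℝ S) F = normalCone S F := by
  ext x
  refine ⟨fun h f hf p hp => h f hf p (subset_convexHull ℝ S hp), fun h f hf => ?_⟩
  have halfSpace_convex : Convex ℝ {p : ι → ℝ | x ⬝ᵥ p ≤ x ⬝ᵥ f} :=
    convex_halfSpace_le ⟨dotProduct_add x, fun c => dotProduct_smul c x⟩ _
  exact convexHull_min (h f hf) halfSpace_convex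

theorem normalCone_segment (p q : ι → ℝ) :
    normalCone (segment ℝ p q) {p} = {x | x ⬝ᵥ q ≤ x ⬝ᵥ p} := by
  ext x
  simp [← convexHull_pair, normalCone_convexHull, mem_normalCone_singleton]

theorem normalCone_add {A B : Set (ι → ℝ)} {a b : ι → ℝ} (ha : a ∈ A) (hb : b ∈ B) :
    normalCone (A + B) {a + b} = normalCone A {a} ∩ normalCone B {b} := by
  ext x
  simp only [Set.mem_inter_iff, mem_normalCone_singleton]
  constructor
  · refine fun h => ⟨fun p hp => ?_, fun q hq => ?_⟩
    · simpa using h _ (Set.add_mem_add hp hb)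
    · simpa using h _ (Set.add_mem_add ha hq)
  · rintro ⟨hA, hB⟩ _ ⟨p, hp, q, hq, rfl⟩
    simpa only [dotProduct_add] using add_le_add (hA p hp) (hB q hq)

theorem normalCone_finsetSum {κ : Type*} (s : Finset κ) {A : κ → Set (ι → ℝ)} {a : κ → ι → ℝ}
    (ha : ∀ k ∈ s, a k ∈ A k) :
    normalCone (∑ k ∈ s, A k) {∑ k ∈ s, a k} = ⋂ k ∈ s, normalCone (A k) {a k} := by
  classical
  induction s using Finset.induction_on with
  | empty =>
    ext x
    simp [mem_normalCone_singleton]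
  | insert k s hk ih =>
    rw [Finset.forall_mem_insert] at ha
    rw [Finset.sum_insert hk, Finset.sum_insert hk,
      normalCone_add ha.1 (Set.finsetSum_mem_finsetSum s A a ha.2), ih ha.2,
      Finset.set_biInter_insert]

theorem dotProduct_append {m n : ℕ} (x : Fin (m + n) → ℝ) (p : Fin m → ℝ) (q : Fin n → ℝ) :
    x ⬝ᵥ Fin.append p q = (x ∘ Fin.castAdd n) ⬝ᵥ p + (x ∘ Fin.natAdd m) ⬝ᵥ q := by
  simp [dotProduct, Fin.sum_univ_add]

theorem normalCone_image2_append {m n : ℕ} {P : Set (Fin m → ℝ)} {Q : Set (Fin n → ℝ)}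
    {p : Fin m → ℝ} {q : Fin n → ℝ} (hp : p ∈ P) (hq : q ∈ Q) :
    normalCone (Set.image2 Fin.append P Q) {Fin.append p q} =
      {x | x ∘ Fin.castAdd n ∈ normalCone P {p} ∧ x ∘ Fin.natAdd m ∈ normalCone Q {q}} := by
  ext x
  simp only [mem_normalCone_singleton, Set.forall_mem_image2, dotProduct_append,
    Set.mem_ofPred_eq]
  constructor
  · refine fun h => ⟨fun p' hp' => ?_, fun q' hq' => ?_⟩
    · simpa using h p' hp' q hq
    · simpa using h p hp q' hq'
  · exact fun ⟨hP, hQ⟩ p' hp' q' hq' => add_le_add (hP p' hp') (hQ q' hq')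

theorem eq_of_mem_interior_normalCone {P : Set (ι → ℝ)} {v x p : ι → ℝ}
    (hx : x ∈ interior (normalCone P {v})) (hp : p ∈ P) (hvp : x ⬝ᵥ v ≤ x ⬝ᵥ p) : p = v := by
  have tendsto_x : Filter.Tendsto (fun t : ℝ => x + t • (p - v)) (nhdsWithin 0 (Set.Ioi 0))
      (nhds x) :=
    tendsto_nhdsWithin_of_tendsto_nhds (Continuous.tendsto' (by fun_prop) _ _ (by simp))
  obtain ⟨t, ht, ht_pos⟩ := ((tendsto_x.eventually (mem_interior_iff_mem_nhds.1 hx)).and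
    self_mem_nhdsWithin).exists
  have hle := mem_normalCone_singleton.1 ht p hp
  have sq_nonpos : t * ((p - v) ⬝ᵥ (p - v)) ≤ 0 := by
    simp only [add_dotProduct, smul_dotProduct, smul_eq_mul] at hle
    rw [dotProduct_sub (p - v) p v, mul_sub]
    linarith
  rw [← sub_eq_zero, ← dotProduct_self_eq_zero]
  exact le_antisymm (nonpos_of_mul_nonpos_right sq_nonpos ht_pos)
    (Finset.sum_nonneg fun i _ => mul_self_nonneg _)

theorem mem_exposedPoints_of_interior_normalCone_nonempty {P : Set (ι → ℝ)} {v : ι → ℝ}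
    (hv : v ∈ P) (h : (interior (normalCone P {v})).Nonempty) : v ∈ P.exposedPoints ℝ := by
  obtain ⟨x, hx⟩ := h
  exact ⟨hv, LinearMap.toContinuousLinearMap (dotProductBilin ℝ ℝ x), fun p hp =>
    ⟨mem_normalCone_singleton.1 (interior_subset hx) p hp, eq_of_mem_interior_normalCone hx hp⟩⟩

theorem eq_of_normalCone_eq {P : Set (ι → ℝ)} {v w : ι → ℝ} (hv : v ∈ P) (hw : w ∈ P)
    (h : (interior (normalCone P {v})).Nonempty) (hvw : normalCone P {w} = normalCone P {v}) :
    w = v := by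
  obtain ⟨x, hx⟩ := h
  have hxw : x ∈ normalCone P {w} := hvw ▸ interior_subset hx
  exact eq_of_mem_interior_normalCone hx hw (mem_normalCone_singleton.1 hxw v hv)

end NormalCone

theorem mem_interior_setOf_le_of_lt {ι α : Type*} [Finite ι] [TopologicalSpace α] [LinearOrder α]
    [OrderClosedTopology α] {r : ι → ι → Prop} {x : ι → α}
    (hx : ∀ i j, r i j → i ≠ j → x i < x j) :
    x ∈ interior {y : ι → α | ∀ i j, r i j → y i ≤ y j} := by
  rw [mem_interior_iff_mem_nhds]
  change ∀ᶠ y in nhds x, _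
  simp only [Filter.eventually_all]
  intro i j hij
  rcases eq_or_ne i j with rfl | hne
  · exact Filter.Eventually.of_forall fun y => le_rfl
  · exact ((continuous_apply i).continuousAt.eventually_lt (continuous_apply j).continuousAt
      (hx i j hij hne)).mono fun y hy => hy.le

section Shuffle

variable {m n : ℕ}

theorem shuffle_eq (P : Set (Fin m → ℝ)) (Q : Set (Fin n → ℝ)) :
    shuffle P Q = Set.image2 Fin.append P Q + ∑ k : Fin m × Fin n,
      segment ℝ (Pi.single (Fin.castAdd n k.1) 1 : Fin (m + n) → ℝ)
        (Pi.single (Fin.natAdd m k.2) 1) := by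
  simp only [shuffle, Set.image2, Fintype.sum_prod_type, eq_comm]

open Classical in
/-- The endpoint of the segment `[e_i, e_{m+j}]` chosen by the relation `D`: the first one if
`D i j` holds, and the second one otherwise. -/
noncomputable def shuffleEnd (D : Fin m → Fin n → Prop) (i : Fin m) (j : Fin n) :
    Fin (m + n) → ℝ :=
  if D i j then Pi.single (Fin.castAdd n i) 1 else Pi.single (Fin.natAdd m j) 1

/-- The point of the shuffle of `P` and `Q` obtained from points `p` of `P` and `q` of `Q` by
choosing the endpoint `shuffleEnd D i j` of each segment `[e_i, e_{m+j}]`. -/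
noncomputable def shufflePoint (D : Fin m → Fin n → Prop) (p : Fin m → ℝ) (q : Fin n → ℝ) :
    Fin (m + n) → ℝ :=
  Fin.append p q + ∑ k : Fin m × Fin n, shuffleEnd D k.1 k.2

variable (D : Fin m → Fin n → Prop)

theorem shuffleEnd_mem_segment (i : Fin m) (j : Fin n) :
    shuffleEnd D i j ∈ segment ℝ (Pi.single (Fin.castAdd n i) 1 : Fin (m + n) → ℝ)
      (Pi.single (Fin.natAdd m j) 1) := by
  rw [shuffleEnd]
  split_ifs
  exacts [left_mem_segment ℝ _ _, right_mem_segment ℝ _ _]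

theorem mem_normalCone_shuffleEnd {i : Fin m} {j : Fin n} {x : Fin (m + n) → ℝ} :
    x ∈ normalCone (segment ℝ (Pi.single (Fin.castAdd n i) 1) (Pi.single (Fin.natAdd m j) 1))
        {shuffleEnd D i j} ↔
      (D i j → x (Fin.natAdd m j) ≤ x (Fin.castAdd n i)) ∧
        (¬ D i j → x (Fin.castAdd n i) ≤ x (Fin.natAdd m j)) := by
  by_cases h : D i j
  · simp [shuffleEnd, h, normalCone_segment]
  · simp [shuffleEnd, h, segment_symm ℝ (Pi.single (Fin.castAdd n i) (1 : ℝ)), normalCone_segment]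

theorem shufflePoint_mem_shuffle {P : Set (Fin m → ℝ)} {Q : Set (Fin n → ℝ)} {p : Fin m → ℝ}
    {q : Fin n → ℝ} (hp : p ∈ P) (hq : q ∈ Q) : shufflePoint D p q ∈ shuffle P Q := by
  rw [shuffle_eq]
  exact Set.add_mem_add (Set.mem_image2_of_mem hp hq)
    (Set.finsetSum_mem_finsetSum _ _ _ fun k _ => shuffleEnd_mem_segment D k.1 k.2)

theorem mem_normalCone_shufflePoint {P : Set (Fin m → ℝ)} {Q : Set (Fin n → ℝ)} {p : Fin m → ℝ}
    {q : Fin n → ℝ} (hp : p ∈ P) (hq : q ∈ Q) {x : Fin (m + n) → ℝ} :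
    x ∈ normalCone (shuffle P Q) {shufflePoint D p q} ↔
      x ∘ Fin.castAdd n ∈ normalCone P {p} ∧ x ∘ Fin.natAdd m ∈ normalCone Q {q} ∧
        ∀ i j, (D i j → x (Fin.natAdd m j) ≤ x (Fin.castAdd n i)) ∧
          (¬ D i j → x (Fin.castAdd n i) ≤ x (Fin.natAdd m j)) := by
  have shuffleEnd_mem (k : Fin m × Fin n) (_ : k ∈ Finset.univ) := shuffleEnd_mem_segment D k.1 k.2
  rw [shuffle_eq, shufflePoint, normalCone_add (Set.mem_image2_of_mem hp hq)
      (Set.finsetSum_mem_finsetSum _ _ _ shuffleEnd_mem),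
    normalCone_finsetSum _ shuffleEnd_mem, normalCone_image2_append hp hq]
  simp [mem_normalCone_shuffleEnd, and_assoc]

theorem shufflePoint_castAdd (p : Fin m → ℝ) (q : Fin n → ℝ) (i : Fin m) :
    shufflePoint D p q (Fin.castAdd n i) = p i + {j | D i j}.ncard := by
  classical
  have shuffleEnd_castAdd (i' : Fin m) (j : Fin n) : shuffleEnd D i' j (Fin.castAdd n i) =
      if i' = i then if D i j then 1 else 0 else 0 := by
    have castAdd_ne_natAdd : Fin.castAdd n i ≠ Fin.natAdd m j :=
      Fin.ne_of_val_ne (i.isLt.trans_le (Nat.le_add_right m j)).ne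
    rcases eq_or_ne i' i with rfl | hi <;> by_cases h : D i' j <;> simp_all [shuffleEnd]
  simp [shufflePoint, shuffleEnd_castAdd, Fintype.sum_prod_type_right, Set.ncard_eq_toFinset_card']

theorem shufflePoint_natAdd (p : Fin m → ℝ) (q : Fin n → ℝ) (j : Fin n) :
    shufflePoint D p q (Fin.natAdd m j) = q j + {i | ¬ D i j}.ncard := by
  classical
  have shuffleEnd_natAdd (i : Fin m) (j' : Fin n) : shuffleEnd D i j' (Fin.natAdd m j) =
      if j' = j then if ¬ D i j then 1 else 0 else 0 := by
    have natAdd_ne_castAdd : Fin.natAdd m j ≠ Fin.castAdd n i :=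
      Fin.ne_of_val_ne (i.isLt.trans_le (Nat.le_add_right m j)).ne'
    rcases eq_or_ne j' j with rfl | hj <;> by_cases h : D i j' <;> simp_all [shuffleEnd]
  simp [shufflePoint, shuffleEnd_natAdd, Fintype.sum_prod_type, Set.ncard_eq_toFinset_card',
    ← Finset.sum_boole]

theorem sum_shufflePoint (p : Fin m → ℝ) (q : Fin n → ℝ) :
    ∑ i, shufflePoint D p q i = ∑ i, p i + ∑ j, q j + m * n := by
  have sum_shuffleEnd (i : Fin m) (j : Fin n) : ∑ k, shuffleEnd D i j k = 1 := by
    rw [shuffleEnd]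
    split_ifs <;> simp
  simp only [shufflePoint, Pi.add_apply, Finset.sum_apply, Finset.sum_add_distrib]
  rw [Finset.sum_comm]
  simp [Fin.sum_univ_add (Fin.append p q), sum_shuffleEnd]

end Shuffle

section Permutahedron

variable {m : ℕ}

/-- The vertex of the permutahedron whose entry at position `σ k` is `k + 1`, for
`k = 0, …, m - 1`. -/
def permutahedronVertex (σ : Equiv.Perm (Fin m)) (a : Fin m) : ℝ :=
  (σ.symm a).val + 1

theorem permutahedron_eq :
    permutahedron m = convexHull ℝ (Set.range (permutahedronVertex (m := m))) := by
  have sum_smul_single (σ : Equiv.Perm (Fin m)) :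
      ∑ k : Fin m, ((k.val : ℝ) + 1) • (Pi.single (σ k) 1 : Fin m → ℝ) =
        permutahedronVertex σ := by
    funext a
    rw [← Equiv.sum_comp σ.symm]
    simp [permutahedronVertex, Finset.sum_apply, Pi.single_apply]
  simp only [permutahedron, sum_smul_single]

theorem permutahedronVertex_mem (σ : Equiv.Perm (Fin m)) :
    permutahedronVertex σ ∈ permutahedron m := by
  rw [permutahedron_eq]
  exact subset_convexHull ℝ _ (Set.mem_range_self σ)

theorem dotProduct_permutahedronVertex (x : Fin m → ℝ) (σ : Equiv.Perm (Fin m)) :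
    x ⬝ᵥ permutahedronVertex σ = ∑ k, x (σ k) * (k.val + 1) := by
  rw [dotProduct, ← Equiv.sum_comp σ]
  simp [permutahedronVertex]

theorem monovary_iff_monotone_of_strictMono {ι α β : Type*} [LinearOrder ι] [Preorder α]
    [LinearOrder β] {f : ι → α} {g : ι → β} (hg : StrictMono g) : Monovary f g ↔ Monotone f :=
  ⟨fun h => monotone_iff_forall_lt.2 fun _ _ hij => h (hg hij), fun h => h.monovary hg.monotone⟩

theorem normalCone_permutahedron (σ : Equiv.Perm (Fin m)) :
    normalCone (permutahedron m) {permutahedronVertex σ} = {x | Monotone (x ∘ σ)} := by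
  have strictMono_succ : StrictMono fun k : Fin m => (k.val : ℝ) + 1 := fun i j hij => by
    simpa using hij
  ext x
  simp only [permutahedron_eq, normalCone_convexHull, mem_normalCone_singleton,
    Set.forall_mem_range, dotProduct_permutahedronVertex, Set.mem_ofPred_eq,
    ← monovary_iff_monotone_of_strictMono strictMono_succ]
  constructor
  · intro h
    have sorted := (monovary_iff_monotone_of_strictMono strictMono_succ).2 (Tuple.monotone_sort x)
    have le_sorted := sorted.sum_comp_perm_mul_le_sum_mul (σ := σ.trans (Tuple.sort x).symm)
    have eq_iff := sorted.sum_comp_perm_mul_eq_sum_mul_iff (σ := σ.trans (Tuple.sort x).symm)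
    simp only [Function.comp_def, Equiv.trans_apply, Equiv.apply_symm_apply] at le_sorted eq_iff
    exact eq_iff.1 (le_antisymm le_sorted (h (Tuple.sort x)))
  · intro h τ
    simpa using h.sum_comp_perm_mul_le_sum_mul (σ := τ.trans σ.symm)

theorem sum_permutahedronVertex (σ : Equiv.Perm (Fin m)) :
    ∑ a, permutahedronVertex σ a = (m + 1).choose 2 := by
  simp only [permutahedronVertex]
  rw [Equiv.sum_comp σ.symm fun k => (k.val : ℝ) + 1, Nat.choose_two_right, ← Finset.sum_range_id,
    Finset.sum_range_succ', Fin.sum_univ_eq_sum_range fun k => (k : ℝ) + 1]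
  simp

end Permutahedron

section IntervalMaxSum

/-- The sum of the maxima of all non-empty intervals (sublists of consecutive entries) of a list.
The maximum of the interval `a :: B` is encoded as `B.foldr max a`. -/
def intervalMaxSum {R : Type*} [AddCommMonoid R] [LinearOrder R] : List R → R
  | [] => 0
  | a :: L => (L.inits.map fun B => B.foldr max a).sum + intervalMaxSum L

/-- The sum of the maxima of the intervals of `L ++ a :: M` that contain the entry `a`. -/
def crossingMaxSum {R : Type*} [AddCommMonoid R] [LinearOrder R] (L : List R) (a : R)
    (M : List R) : R :=
  ((L.tails ×ˢ M.inits).map fun AB => (AB.1 ++ AB.2).foldr max a).sum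

theorem foldr_max_le_iff {R : Type*} [LinearOrder R] {L : List R} {a c : R} :
    L.foldr max a ≤ c ↔ a ≤ c ∧ ∀ x ∈ L, x ≤ c := by
  induction L with
  | nil => simp
  | cons b L ih => simp [ih, and_left_comm]

theorem le_foldr_max {R : Type*} [LinearOrder R] (L : List R) (a : R) : a ≤ L.foldr max a :=
  (foldr_max_le_iff.1 le_rfl).1

theorem foldr_max_append_cons {R : Type*} [LinearOrder R] (L M : List R) (a b : R) :
    (L ++ a :: M).foldr max b = (b :: L ++ M).foldr max a :=
  eq_of_forall_ge_iff fun c => by grind [foldr_max_le_iff]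

theorem intervalMaxSum_append_cons {R : Type*} [AddCommMonoid R] [LinearOrder R] (L M : List R)
    (a : R) :
    intervalMaxSum (L ++ a :: M) =
      intervalMaxSum L + crossingMaxSum L a M + intervalMaxSum M := by
  induction L with
  | nil => simp [intervalMaxSum, crossingMaxSum, SProd.sprod, List.product, Function.comp_def]
  | cons b L ih =>
    have sum_inits : ((L ++ a :: M).inits.map fun B => B.foldr max b).sum =
        (L.inits.map fun B => B.foldr max b).sum +
          (M.inits.map fun B => (b :: L ++ B).foldr max a).sum := by
      simp only [List.inits_append, List.inits_cons, List.tail_cons, List.map_append,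
        List.map_map, List.sum_append, Function.comp_def, foldr_max_append_cons]
    have crossing_cons : crossingMaxSum (b :: L) a M =
        (M.inits.map fun B => (b :: L ++ B).foldr max a).sum + crossingMaxSum L a M := by
      simp [crossingMaxSum, List.product_cons, Function.comp_def]
    rw [List.cons_append, intervalMaxSum, intervalMaxSum, sum_inits, ih, crossing_cons]
    abel

theorem nsmul_le_crossingMaxSum {R : Type*} [AddCommMonoid R] [LinearOrder R]
    [IsOrderedAddMonoid R] (L : List R) (a : R) (M : List R) :
    ((L.length + 1) * (M.length + 1)) • a ≤ crossingMaxSum L a M := by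
  rw [← L.length_tails, ← M.length_inits, ← List.length_product, ← List.length_map]
  exact List.card_nsmul_le_sum _ a (List.forall_mem_map.2 fun AB _ => le_foldr_max _ a)

variable {R : Type*} [AddCommMonoid R] [LinearOrder R] [IsOrderedCancelAddMonoid R]

theorem length_nsmul_eq_sum_iff {L : List R} {a : R} (h : ∀ x ∈ L, a ≤ x) :
    L.length • a = L.sum ↔ ∀ x ∈ L, a = x := by
  induction L with
  | nil => simp
  | cons b L ih =>
    rw [List.forall_mem_cons] at h ⊢
    rw [← ih h.2, ← add_eq_add_iff_eq_and_eq h.1 (L.card_nsmul_le_sum a h.2), List.sum_cons,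
      List.length_cons, succ_nsmul']

theorem nsmul_eq_crossingMaxSum_iff {L : List R} {a : R} {M : List R} :
    ((L.length + 1) * (M.length + 1)) • a = crossingMaxSum L a M ↔ ∀ x ∈ L ++ M, x ≤ a := by
  rw [← L.length_tails, ← M.length_inits, ← List.length_product, crossingMaxSum,
    ← List.length_map fun AB : List R × List R => (AB.1 ++ AB.2).foldr max a,
    length_nsmul_eq_sum_iff (List.forall_mem_map.2 fun AB _ => le_foldr_max _ a),
    List.forall_mem_map]
  simp only [(le_foldr_max _ a).ge_iff_eq.symm, foldr_max_le_iff, le_rfl, true_and]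
  constructor
  · exact fun h => h (L, M) (by simp)
  · rintro h ⟨A, B⟩ hAB x hx
    obtain ⟨hA, hB⟩ := List.pair_mem_product.1 hAB
    rcases List.mem_append.1 hx with hx | hx
    · exact h x (List.mem_append_left _ (((List.mem_tails A L).1 hA).subset hx))
    · exact h x (List.mem_append_right _ (((List.mem_inits B M).1 hB).subset hx))

end IntervalMaxSum

theorem add_choose_two (a b : ℕ) : (a + b).choose 2 = a.choose 2 + a * b + b.choose 2 := by
  rw [← Nat.cast_inj (R := ℚ)]
  push_cast [Nat.cast_choose_two]
  ring

namespace PTree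

section WeightedSum

theorem map_inorder_unary {α : Type*} (t : PTree) (y : List Bool → α) :
    t.unary.inorder.map y = t.inorder.map (y ∘ List.cons false) := by
  rw [inorder, List.map_map]

theorem map_inorder_binary {α : Type*} (l r : PTree) (y : List Bool → α) :
    (binary l r).inorder.map y =
      l.inorder.map (y ∘ List.cons false) ++ y [] :: r.inorder.map (y ∘ List.cons true) := by
  rw [inorder, List.map_append, List.map_cons, List.map_map, List.map_map]

theorem length_map_inorder {α : Type*} (T : PTree) (y : List Bool → α) :
    (T.inorder.map y).length + 1 = T.numLeaves := by
  rw [List.length_map, length_inorder]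

/-- The product of the numbers of leaves in the two subtrees of the binary node at `p`. -/
def leafProduct (T : PTree) (p : List Bool) : ℕ :=
  T.leftLeaves p * T.rightLeaves p

theorem map_leafProduct_inorder_unary (t : PTree) :
    t.unary.inorder.map t.unary.leafProduct = t.inorder.map t.leafProduct :=
  map_inorder_unary t _

theorem map_leafProduct_inorder_binary (l r : PTree) :
    (binary l r).inorder.map (binary l r).leafProduct =
      l.inorder.map l.leafProduct ++ l.numLeaves * r.numLeaves :: r.inorder.map r.leafProduct :=
  map_inorder_binary l r _

theorem sum_map_leafProduct_inorder (T : PTree) :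
    (T.inorder.map T.leafProduct).sum = T.numLeaves.choose 2 := by
  induction T with
  | leaf => rfl
  | unary t ih => rw [map_leafProduct_inorder_unary, ih, numLeaves]
  | binary l r ihl ihr =>
    rw [map_leafProduct_inorder_binary, List.sum_append, List.sum_cons, ihl, ihr, numLeaves,
      add_choose_two, add_assoc]

/-- The values `y` at the binary nodes of `T` weakly decrease along the paths starting at the
root. -/
def IsDecreasing {α : Type*} [LE α] (T : PTree) (y : List Bool → α) : Prop :=
  ∀ p ∈ T.inorder, ∀ q ∈ T.inorder, q <+: p → y p ≤ y q

theorem isDecreasing_unary {α : Type*} [LE α] {t : PTree} {y : List Bool → α} :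
    t.unary.IsDecreasing y ↔ t.IsDecreasing (y ∘ List.cons false) := by
  simp [IsDecreasing, inorder, List.cons_prefix_cons]

theorem isDecreasing_binary {α : Type*} [Preorder α] {l r : PTree} {y : List Bool → α} :
    (binary l r).IsDecreasing y ↔
      l.IsDecreasing (y ∘ List.cons false) ∧
        (∀ a ∈ l.inorder.map (y ∘ List.cons false) ++ r.inorder.map (y ∘ List.cons true),
          a ≤ y []) ∧
        r.IsDecreasing (y ∘ List.cons true) := by
  simp [IsDecreasing, inorder, List.cons_prefix_cons, or_imp, forall_and]

theorem exists_isDecreasing {α : Type*} [LinearOrder α] [Nonempty α] (L : List α) :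
    ∃ (T : PTree) (y : List Bool → α), T.inorder.map y = L ∧ T.IsDecreasing y := by
  induction hn : L.length using Nat.strong_induction_on generalizing L with
  | _ n ih =>
    subst hn
    rcases eq_or_ne L [] with rfl | hL
    · exact ⟨leaf, Classical.arbitrary _, rfl, by simp [IsDecreasing, inorder]⟩
    · obtain ⟨a, ha, ha_max⟩ := L.toFinset.exists_max_image id
        ((List.toFinset_nonempty_iff L).2 hL)
      simp only [List.mem_toFinset, id_eq] at ha ha_max
      obtain ⟨A, B, rfl⟩ := List.append_of_mem ha
      obtain ⟨l, yl, rfl, hl⟩ := ih A.length (by simp) A rfl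
      obtain ⟨r, yr, rfl, hr⟩ := ih B.length (by simp; lia) B rfl
      let y : List Bool → α
        | [] => a
        | false :: p => yl p
        | true :: p => yr p
      refine ⟨binary l r, y, map_inorder_binary l r y, isDecreasing_binary.2 ⟨hl, ?_, hr⟩⟩
      exact fun b hb => ha_max b <|
        List.mem_append.2 ((List.mem_append.1 hb).imp_right (List.mem_cons_of_mem a))

variable {R : Type*} [AddCommMonoid R]

/-- The scalar product of the values `y` at the binary nodes of `T` with the vertex of the
associahedron given by `T`. -/
def weightedSum (T : PTree) (y : List Bool → R) : R :=
  (T.inorder.map fun p => T.leafProduct p • y p).sum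

theorem weightedSum_unary (t : PTree) (y : List Bool → R) :
    t.unary.weightedSum y = t.weightedSum (y ∘ List.cons false) := by
  rw [weightedSum, map_inorder_unary]
  rfl

theorem weightedSum_binary (l r : PTree) (y : List Bool → R) :
    (binary l r).weightedSum y = l.weightedSum (y ∘ List.cons false) +
      (l.numLeaves * r.numLeaves) • y [] + r.weightedSum (y ∘ List.cons true) := by
  rw [weightedSum, map_inorder_binary, List.sum_append, List.sum_cons, ← add_assoc]
  rfl

variable [LinearOrder R]

theorem nsmul_root_le_crossingMaxSum [IsOrderedAddMonoid R] (l r : PTree) (y : List Bool → R) :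
    (l.numLeaves * r.numLeaves) • y [] ≤
      crossingMaxSum (l.inorder.map (y ∘ List.cons false)) (y [])
        (r.inorder.map (y ∘ List.cons true)) := by
  rw [← l.length_map_inorder, ← r.length_map_inorder]
  exact nsmul_le_crossingMaxSum _ _ _

theorem weightedSum_le_intervalMaxSum [IsOrderedAddMonoid R] (T : PTree) (y : List Bool → R) :
    T.weightedSum y ≤ intervalMaxSum (T.inorder.map y) := by
  induction T generalizing y with
  | leaf => rfl
  | unary t ih =>
    rw [weightedSum_unary, map_inorder_unary]
    exact ih _
  | binary l r ihl ihr =>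
    rw [weightedSum_binary, map_inorder_binary, intervalMaxSum_append_cons]
    exact add_le_add (add_le_add (ihl _) (nsmul_root_le_crossingMaxSum l r y)) (ihr _)

theorem weightedSum_eq_intervalMaxSum_iff [IsOrderedCancelAddMonoid R] {T : PTree}
    {y : List Bool → R} :
    T.weightedSum y = intervalMaxSum (T.inorder.map y) ↔ T.IsDecreasing y := by
  induction T generalizing y with
  | leaf => simp [weightedSum, intervalMaxSum, IsDecreasing, inorder]
  | unary t ih => rw [weightedSum_unary, map_inorder_unary, isDecreasing_unary, ih]
  | binary l r ihl ihr =>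
    have le_left := l.weightedSum_le_intervalMaxSum (y ∘ List.cons false)
    have le_right := r.weightedSum_le_intervalMaxSum (y ∘ List.cons true)
    have le_root := nsmul_root_le_crossingMaxSum l r y
    rw [weightedSum_binary, map_inorder_binary, intervalMaxSum_append_cons,
      add_eq_add_iff_eq_and_eq (add_le_add le_left le_root) le_right,
      add_eq_add_iff_eq_and_eq le_left le_root, ihl, ihr,
      ← l.length_map_inorder (y ∘ List.cons false), ← r.length_map_inorder (y ∘ List.cons true),
      nsmul_eq_crossingMaxSum_iff, isDecreasing_binary, and_assoc]

end WeightedSum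

section ContractUnary

/-- The binary tree obtained by contracting all nodes of degree one. -/
def contractUnary : PTree → PTree
  | leaf => leaf
  | unary t => t.contractUnary
  | binary l r => binary l.contractUnary r.contractUnary

theorem numLeaves_contractUnary (T : PTree) : T.contractUnary.numLeaves = T.numLeaves := by
  induction T with
  | leaf => rfl
  | unary _ ih => exact ih
  | binary l r ihl ihr => rw [contractUnary, numLeaves, numLeaves, ihl, ihr]

theorem map_leafProduct_inorder_contractUnary (T : PTree) :
    T.contractUnary.inorder.map T.contractUnary.leafProduct = T.inorder.map T.leafProduct := by
  induction T with
  | leaf => rfl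
  | unary _ ih => rw [contractUnary, ih, map_leafProduct_inorder_unary]
  | binary l r ihl ihr =>
    rw [contractUnary, map_leafProduct_inorder_binary, map_leafProduct_inorder_binary, ihl, ihr,
      numLeaves_contractUnary, numLeaves_contractUnary]

theorem not_isUnaryAt_contractUnary (T : PTree) (p : List Bool) :
    ¬ T.contractUnary.IsUnaryAt p := by
  induction T generalizing p with
  | leaf => cases p <;> simp [contractUnary, IsUnaryAt, subtree]
  | unary _ ih => exact ih p
  | binary l r ihl ihr =>
    rcases p with _ | ⟨_ | _, p⟩
    · simp [contractUnary, IsUnaryAt, subtree]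
    · exact ihl p
    · exact ihr p

end ContractUnary

section Associahedron

variable {n : ℕ} {T : PTree} (hT : T.numLeaves = n + 1)

theorem ofFn_inorderNode : List.ofFn (T.inorderNode hT) = T.inorder := by
  have := T.length_inorder
  exact List.ext_getElem (by rw [List.length_ofFn]; lia) fun i _ _ => List.getElem_ofFn _

theorem sum_inorderNode {R : Type*} [AddCommMonoid R] (f : List Bool → R) :
    ∑ i, f (T.inorderNode hT i) = (T.inorder.map f).sum := by
  rw [← ofFn_inorderNode hT, List.map_ofFn, List.sum_ofFn]
  rfl

theorem mem_inorder {p : List Bool} : p ∈ T.inorder ↔ T.IsBinaryAt p := by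
  induction T generalizing p with
  | leaf => cases p <;> simp [inorder, IsBinaryAt, subtree]
  | unary t ih =>
    rcases p with _ | ⟨_ | _, p⟩ <;> simp [inorder, IsBinaryAt, subtree, ih]
  | binary l r ihl ihr =>
    rcases p with _ | ⟨_ | _, p⟩ <;> simp [inorder, IsBinaryAt, subtree, ihl, ihr]

theorem nodup_inorder : T.inorder.Nodup := by
  induction T with
  | leaf => exact List.nodup_nil
  | unary _ ih => exact ih.map List.cons_injective
  | binary l r ihl ihr =>
    rw [inorder, List.nodup_middle, List.nodup_cons, List.nodup_append]
    refine ⟨by simp, ihl.map List.cons_injective, ihr.map List.cons_injective, by simp⟩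

theorem inorderNode_injective : Function.Injective (T.inorderNode hT) := by
  rw [← List.nodup_ofFn, ofFn_inorderNode]
  exact nodup_inorder

theorem mem_range_inorderNode {p : List Bool} :
    p ∈ Set.range (T.inorderNode hT) ↔ T.IsBinaryAt p := by
  rw [← mem_inorder, ← ofFn_inorderNode hT, List.mem_ofFn]
  rfl

/-- The vertex of the associahedron given by the tree `T`, whose nodes of degree one are
ignored. -/
def lodayVertex (i : Fin n) : ℝ :=
  (T.leftLeaves (T.inorderNode hT i) : ℝ) * T.rightLeaves (T.inorderNode hT i)

theorem ofFn_lodayVertex :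
    List.ofFn (lodayVertex hT) = (T.inorder.map T.leafProduct).map Nat.cast := by
  rw [← ofFn_inorderNode hT, List.map_ofFn, List.map_ofFn]
  exact congrArg List.ofFn (funext fun i => (Nat.cast_mul _ _).symm)

theorem lodayVertex_mem_associahedron : lodayVertex hT ∈ associahedron n := by
  have hT' : T.contractUnary.numLeaves = n + 1 := by rw [numLeaves_contractUnary, hT]
  refine subset_convexHull ℝ _ ⟨T.contractUnary, hT', T.not_isUnaryAt_contractUnary, ?_⟩
  change lodayVertex hT = lodayVertex hT'
  rw [← List.ofFn_inj, ofFn_lodayVertex, ofFn_lodayVertex, map_leafProduct_inorder_contractUnary]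

theorem sum_lodayVertex : ∑ i, lodayVertex hT i = (n + 1).choose 2 := by
  rw [← List.sum_ofFn, ofFn_lodayVertex, ← Nat.cast_list_sum, sum_map_leafProduct_inorder, hT]

theorem dotProduct_lodayVertex (y : List Bool → ℝ) :
    (y ∘ T.inorderNode hT) ⬝ᵥ lodayVertex hT = T.weightedSum y := by
  rw [weightedSum, ← sum_inorderNode hT]
  simp [dotProduct, lodayVertex, leafProduct, mul_comm]

theorem dotProduct_lodayVertex_le (x : Fin n → ℝ) :
    x ⬝ᵥ lodayVertex hT ≤ intervalMaxSum (List.ofFn x) := by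
  obtain ⟨y, rfl⟩ := (inorderNode_injective hT).surjective_comp_right x
  rw [dotProduct_lodayVertex, ← List.map_ofFn, ofFn_inorderNode]
  exact T.weightedSum_le_intervalMaxSum y

theorem dotProduct_lodayVertex_eq_iff {x : Fin n → ℝ} :
    x ⬝ᵥ lodayVertex hT = intervalMaxSum (List.ofFn x) ↔
      ∀ i j, T.inorderNode hT j <+: T.inorderNode hT i → x i ≤ x j := by
  obtain ⟨y, rfl⟩ := (inorderNode_injective hT).surjective_comp_right x
  rw [dotProduct_lodayVertex, ← List.map_ofFn, ofFn_inorderNode, weightedSum_eq_intervalMaxSum_iff]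
  simp only [IsDecreasing, ← ofFn_inorderNode hT, List.forall_mem_ofFn_iff, Function.comp_apply]

theorem exists_dotProduct_lodayVertex_eq (x : Fin n → ℝ) :
    ∃ (S : PTree) (hS : S.numLeaves = n + 1),
      x ⬝ᵥ lodayVertex hS = intervalMaxSum (List.ofFn x) := by
  obtain ⟨S, y, hy, hS⟩ := exists_isDecreasing (List.ofFn x)
  have numLeaves_eq : S.numLeaves = n + 1 := by
    rw [← S.length_map_inorder y, hy, List.length_ofFn]
  refine ⟨S, numLeaves_eq, ?_⟩
  rw [← ofFn_inorderNode numLeaves_eq, List.map_ofFn, List.ofFn_inj] at hy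
  rw [← hy, dotProduct_lodayVertex, weightedSum_eq_intervalMaxSum_iff.2 hS, ← List.map_ofFn,
    ofFn_inorderNode]

theorem normalCone_associahedron :
    normalCone (associahedron n) {lodayVertex hT} =
      {x | ∀ i j, T.inorderNode hT j <+: T.inorderNode hT i → x i ≤ x j} := by
  ext x
  rw [Set.mem_ofPred_eq, ← dotProduct_lodayVertex_eq_iff]
  constructor
  · intro h
    obtain ⟨S, hS, dotProduct_eq⟩ := exists_dotProduct_lodayVertex_eq x
    refine le_antisymm (dotProduct_lodayVertex_le hT x) ?_
    rw [← dotProduct_eq]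
    exact mem_normalCone_singleton.1 h _ (lodayVertex_mem_associahedron hS)
  · intro h
    rw [associahedron, normalCone_convexHull, mem_normalCone_singleton, h]
    rintro _ ⟨S, hS, -, rfl⟩
    exact dotProduct_lodayVertex_le hS x

end Associahedron

section Cut

variable {T : PTree} {p q : List Bool} {C : Set (List Bool)}

theorem subtree_append {t : PTree} (h : T.subtree p = some t) (q : List Bool) :
    T.subtree (p ++ q) = t.subtree q := by
  induction p generalizing T with
  | nil =>
    obtain rfl : T = t := by simpa [subtree] using h
    rw [List.nil_append]
  | cons b p ih => cases T <;> cases b <;> first | exact ih h | simp [subtree] at h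

theorem exists_isLeafAt (T : PTree) : ∃ q, T.IsLeafAt q := by
  induction T with
  | leaf => exact ⟨[], rfl⟩
  | unary _ ih => exact ih.imp' (List.cons false) fun _ h => h
  | binary _ _ ihl _ => exact ihl.imp' (List.cons false) fun _ h => h

theorem IsNodeAt.exists_isLeafAt (h : T.IsNodeAt p) : ∃ q, T.IsLeafAt q ∧ p <+: q := by
  obtain ⟨t, ht⟩ : ∃ t, T.subtree p = some t := by
    rcases h with ⟨t, ht⟩ | ⟨l, r, ht⟩
    exacts [⟨_, ht⟩, ⟨_, ht⟩]
  obtain ⟨q, hq⟩ := t.exists_isLeafAt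
  exact ⟨p ++ q, by rw [IsLeafAt, subtree_append ht, hq], List.prefix_append p q⟩

theorem IsUnaryAt.not_isBinaryAt (h : T.IsUnaryAt p) : ¬ T.IsBinaryAt p := by
  rintro ⟨l, r, h'⟩
  obtain ⟨t, h⟩ := h
  simp [h] at h'

theorem IsCut.eq_of_prefix (hC : T.IsCut C) (hp : p ∈ C) (hq : q ∈ C) (h : p <+: q) : p = q := by
  obtain ⟨s, hs, hqs⟩ := (hC.1 q hq).exists_isLeafAt
  exact (hC.2 s hs).unique ⟨hp, h.trans hqs⟩ ⟨hq, hqs⟩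

theorem IsCut.exists_comparable (hC : T.IsCut C) (hp : T.IsNodeAt p) :
    ∃ q ∈ C, q <+: p ∨ p <+: q := by
  obtain ⟨s, hs, hps⟩ := hp.exists_isLeafAt
  obtain ⟨q, ⟨hq, hqs⟩, -⟩ := hC.2 s hs
  exact ⟨q, hq, List.prefix_or_prefix_of_prefix hqs hps⟩

theorem IsCut.nonempty (hC : T.IsCut C) : C.Nonempty := by
  obtain ⟨s, hs⟩ := T.exists_isLeafAt
  obtain ⟨q, ⟨hq, -⟩, -⟩ := hC.2 s hs
  exact ⟨q, hq⟩

end Cut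

end PTree

namespace BinaryPaintedTree

variable {m n : ℕ} (PT : BinaryPaintedTree m n)

theorem cut_subset_of_lt {k l : Fin m} (h : k < l) :
    PT.cut l ⊆ PT.tree.stump (PT.cut k) \ PT.cut k := by
  obtain ⟨l, hl⟩ := l
  replace h : k.val + 1 ≤ l := h
  induction l, h using Nat.le_induction with
  | base => exact PT.cut_subset k ⟨_, hl⟩ rfl
  | succ l _ ih =>
    intro p hp
    have hl' : l < m := by lia
    obtain ⟨⟨hp_node, q, hq, hpq⟩, -⟩ := PT.cut_subset ⟨l, hl'⟩ ⟨l + 1, hl⟩ rfl hp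
    obtain ⟨⟨-, r, hr, hqr⟩, hqk⟩ := ih hl' hq
    refine ⟨⟨hp_node, r, hr, hpq.trans hqr⟩, fun hpk => ?_⟩
    obtain rfl := (PT.isCut k).eq_of_prefix hpk hr (hpq.trans hqr)
    exact hqk (by rwa [hqr.eq_of_length_le hpq.length_le])

theorem le_of_prefix {k l : Fin m} {p q : List Bool} (hp : p ∈ PT.cut k) (hq : q ∈ PT.cut l)
    (h : q <+: p) : k ≤ l := by
  by_contra! hlk
  obtain ⟨⟨-, q', hq', hpq⟩, hpl⟩ := PT.cut_subset_of_lt hlk hp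
  obtain rfl := (PT.isCut l).eq_of_prefix hq hq' (h.trans hpq)
  exact hpl (by rwa [hpq.eq_of_length_le h.length_le])

theorem exists_prolongation {k l : Fin m} (h : k ≤ l) {q : List Bool} (hq : q ∈ PT.cut l) :
    ∃ p ∈ PT.cut k, q <+: p := by
  rcases h.eq_or_lt with rfl | h
  · exact ⟨q, hq, List.prefix_rfl⟩
  · exact (PT.cut_subset_of_lt h hq).1.2

theorem exists_prefix {k l : Fin m} (h : k ≤ l) {p : List Bool} (hp : p ∈ PT.cut k) :
    ∃ q ∈ PT.cut l, q <+: p := by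
  obtain ⟨q, hq, hqp | hpq⟩ := (PT.isCut l).exists_comparable ((PT.isCut k).1 p hp)
  · exact ⟨q, hq, hqp⟩
  · obtain ⟨p', hp', hqp'⟩ := PT.exists_prolongation h hq
    obtain rfl := (PT.isCut k).eq_of_prefix hp hp' (hpq.trans hqp')
    exact ⟨q, hq, hqp'⟩

theorem node_injective : Function.Injective PT.node :=
  PTree.inorderNode_injective PT.numLeaves_tree

theorem range_node : Set.range PT.node = {p | PT.tree.IsBinaryAt p} :=
  Set.ext fun _ => PTree.mem_range_inorderNode PT.numLeaves_tree

theorem isBinaryAt_node (j : Fin n) : PT.tree.IsBinaryAt (PT.node j) :=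
  PT.range_node.subset (Set.mem_range_self j)

/-- The binary node labeled by `j` is below the cut labeled by `a`. -/
def NodeBelowCut (a : Fin m) (j : Fin n) : Prop :=
  ∃ q ∈ PT.cutLabeled a, q <+: PT.node j

theorem not_nodeBelowCut_iff {a : Fin m} {j : Fin n} :
    ¬ PT.NodeBelowCut a j ↔ ∃ q ∈ PT.cutLabeled a, PT.node j <+: q := by
  have isCut_a := PT.isCut (PT.label.symm a)
  constructor
  · intro h
    obtain ⟨q, hq, hqj | hjq⟩ := isCut_a.exists_comparable (Or.inr (PT.isBinaryAt_node j))
    · exact absurd ⟨q, hq, hqj⟩ h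
    · exact ⟨q, hq, hjq⟩
  · rintro ⟨q, hq, hjq⟩ ⟨p, hp, hpj⟩
    obtain rfl := isCut_a.eq_of_prefix hp hq (hpj.trans hjq)
    have unary_p := PT.unary_of_mem p (isCut_a.1 p hp) ⟨_, hp⟩
    rw [hpj.eq_of_length_le hjq.length_le] at unary_p
    exact unary_p.not_isBinaryAt (PT.isBinaryAt_node j)

theorem forall_exists_prefix_iff {a b : Fin m} :
    (∀ p ∈ PT.cutLabeled b, ∃ q ∈ PT.cutLabeled a, q <+: p) ↔
      PT.label.symm b ≤ PT.label.symm a := by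
  refine ⟨fun h => ?_, fun h p hp => PT.exists_prefix h hp⟩
  obtain ⟨p, hp⟩ := (PT.isCut (PT.label.symm b)).nonempty
  obtain ⟨q, hq, hqp⟩ := h p hp
  exact PT.le_of_prefix hp hq hqp

theorem numCutsBelowCut_eq (a : Fin m) : PT.numCutsBelowCut a = (PT.label.symm a).val + 1 := by
  simp only [numCutsBelowCut, forall_exists_prefix_iff]
  change (PT.label.symm ⁻¹' Set.Iic (PT.label.symm a)).ncard = _
  rw [← Equiv.image_eq_preimage_symm, Set.ncard_image_of_injective _ PT.label.injective,
    Set.ncard_eq_toFinset_card', Set.toFinset_Iic, Fin.card_Iic]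

theorem numNodesBelowCut_eq (a : Fin m) :
    PT.numNodesBelowCut a = {j | PT.NodeBelowCut a j}.ncard := by
  rw [numNodesBelowCut, ← Set.ncard_image_of_injective _ PT.node_injective, Set.ofPred_and,
    ← range_node, Set.inter_comm, ← Set.image_preimage_eq_inter_range]
  rfl

theorem numCutsBelowNode_eq (j : Fin n) :
    PT.numCutsBelowNode (PT.node j) = {a | ¬ PT.NodeBelowCut a j}.ncard := by
  simp only [numCutsBelowNode, not_nodeBelowCut_iff]

/-- The relation that generates the preposet. -/
def Below (i j : Fin (m + n)) : Prop :=
  ∃ p ∈ PT.nodesLabeled i, ∃ q ∈ PT.nodesLabeled j, q <+: p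

theorem nodesLabeled_castAdd (a : Fin m) :
    PT.nodesLabeled (Fin.castAdd n a) = PT.cutLabeled a :=
  Fin.addCases_left a

theorem nodesLabeled_natAdd (j : Fin n) : PT.nodesLabeled (Fin.natAdd m j) = {PT.node j} :=
  Fin.addCases_right j

theorem below_cut_cut {a b : Fin m} :
    PT.Below (Fin.castAdd n a) (Fin.castAdd n b) ↔ PT.label.symm a ≤ PT.label.symm b := by
  simp only [Below, nodesLabeled_castAdd]
  constructor
  · rintro ⟨p, hp, q, hq, h⟩
    exact PT.le_of_prefix hp hq h
  · intro h
    obtain ⟨p, hp⟩ := (PT.isCut (PT.label.symm a)).nonempty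
    exact ⟨p, hp, PT.exists_prefix h hp⟩

theorem below_node_cut {j : Fin n} {a : Fin m} :
    PT.Below (Fin.natAdd m j) (Fin.castAdd n a) ↔ PT.NodeBelowCut a j := by
  simp [Below, nodesLabeled_castAdd, nodesLabeled_natAdd, NodeBelowCut]

theorem below_cut_node {a : Fin m} {j : Fin n} :
    PT.Below (Fin.castAdd n a) (Fin.natAdd m j) ↔ ¬ PT.NodeBelowCut a j := by
  simp [Below, nodesLabeled_castAdd, nodesLabeled_natAdd, not_nodeBelowCut_iff]

theorem below_node_node {i j : Fin n} :
    PT.Below (Fin.natAdd m i) (Fin.natAdd m j) ↔ PT.node j <+: PT.node i := by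
  simp [Below, nodesLabeled_natAdd]

theorem cone_eq : PT.cone = {x | ∀ i j, PT.Below i j → x i ≤ x j} := by
  ext x
  refine ⟨fun h i j hij => h i j (Relation.ReflTransGen.single hij), fun h i j hij => ?_⟩
  induction hij with
  | refl => exact le_rfl
  | tail _ hjk ih => exact ih.trans (h _ _ hjk)

section Height

theorem exists_prolongation_of_below {a : Fin m} {i : Fin (m + n)}
    (h : PT.Below (Fin.castAdd n a) i) {p : List Bool} (hp : p ∈ PT.nodesLabeled i) :
    ∃ q ∈ PT.cutLabeled a, p <+: q := by
  induction i using Fin.addCases with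
  | left b =>
    rw [nodesLabeled_castAdd] at hp
    exact PT.exists_prolongation (PT.below_cut_cut.1 h) hp
  | right j =>
    rw [nodesLabeled_natAdd, Set.mem_singleton_iff] at hp
    rw [hp]
    exact PT.not_nodeBelowCut_iff.1 (PT.below_cut_node.1 h)

theorem below_trans_of_cut {a : Fin m} {i j : Fin (m + n)} (hai : PT.Below (Fin.castAdd n a) i)
    (hij : PT.Below i j) : PT.Below (Fin.castAdd n a) j := by
  obtain ⟨p, hp, q, hq, hqp⟩ := hij
  obtain ⟨s, hs, hps⟩ := PT.exists_prolongation_of_below hai hp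
  exact ⟨s, (PT.nodesLabeled_castAdd a).symm ▸ hs, q, hq, hqp.trans hps⟩

/-- The number of cuts that are below, or equal to, the cut or node labeled by `i`. -/
noncomputable def numCutsBelow (i : Fin (m + n)) : ℕ :=
  {a | PT.Below (Fin.castAdd n a) i}.ncard

theorem numCutsBelow_le {i j : Fin (m + n)} (h : PT.Below i j) :
    PT.numCutsBelow i ≤ PT.numCutsBelow j :=
  Set.ncard_le_ncard fun _ hai => PT.below_trans_of_cut hai h

theorem numCutsBelow_lt {i : Fin (m + n)} {b : Fin m} (h : PT.Below i (Fin.castAdd n b))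
    (h' : ¬ PT.Below (Fin.castAdd n b) i) :
    PT.numCutsBelow i < PT.numCutsBelow (Fin.castAdd n b) :=
  Set.ncard_lt_ncard ((Set.ssubset_iff_of_subset fun _ hai => PT.below_trans_of_cut hai h).2
    ⟨b, PT.below_cut_cut.2 le_rfl, h'⟩)

/-- A function on the labels that strictly increases along `Below`, that is, towards the root. The
binary nodes with the same number of cuts below them are ordered by their depth. -/
noncomputable def height : Fin (m + n) → ℝ :=
  Fin.append (fun a => PT.numCutsBelow (Fin.castAdd n a))
    fun j => PT.numCutsBelow (Fin.natAdd m j) + ((PT.node j).length + 2 : ℝ)⁻¹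

theorem height_lt {i j : Fin (m + n)} (h : PT.Below i j) (hne : i ≠ j) :
    PT.height i < PT.height j := by
  have inv_pos (j : Fin n) : 0 < ((PT.node j).length + 2 : ℝ)⁻¹ := by positivity
  have inv_lt_one (j : Fin n) : ((PT.node j).length + 2 : ℝ)⁻¹ < 1 :=
    inv_lt_one_of_one_lt₀ (by linarith [(PT.node j).length.cast_nonneg (α := ℝ)])
  have numCutsBelow_le : (PT.numCutsBelow i : ℝ) ≤ PT.numCutsBelow j :=
    mod_cast PT.numCutsBelow_le h
  induction i using Fin.addCases with
  | left a =>
    induction j using Fin.addCases with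
    | left b =>
      simp only [height, Fin.append_left, Nat.cast_lt]
      refine PT.numCutsBelow_lt h fun h' => hne ?_
      rw [PT.label.symm.injective (le_antisymm (PT.below_cut_cut.1 h) (PT.below_cut_cut.1 h'))]
    | right j =>
      simp only [height, Fin.append_left, Fin.append_right]
      linarith [inv_pos j]
  | right i =>
    induction j using Fin.addCases with
    | left b =>
      have numCutsBelow_lt := PT.numCutsBelow_lt h fun h' =>
        PT.below_cut_node.1 h' (PT.below_node_cut.1 h)
      simp only [height, Fin.append_left, Fin.append_right]
      have : (PT.numCutsBelow (Fin.natAdd m i) : ℝ) + 1 ≤ PT.numCutsBelow (Fin.castAdd n b) :=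
        mod_cast numCutsBelow_lt
      linarith [inv_lt_one i]
    | right j =>
      have prefix_ij := PT.below_node_node.1 h
      have length_lt : (PT.node j).length < (PT.node i).length :=
        lt_of_not_ge fun hle => hne (by rw [PT.node_injective (prefix_ij.eq_of_length_le hle)])
      simp only [height, Fin.append_right]
      exact add_lt_add_of_le_of_lt numCutsBelow_le (by gcongr)

theorem interior_cone_nonempty : (interior PT.cone).Nonempty :=
  ⟨PT.height, PT.cone_eq ▸ mem_interior_setOf_le_of_lt fun _ _ => PT.height_lt⟩

end Height

/-- The vertex of the multiplihedron that corresponds to the painted tree. -/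
noncomputable def vertex : Fin (m + n) → ℝ :=
  shufflePoint PT.NodeBelowCut (permutahedronVertex PT.label)
    (PTree.lodayVertex PT.numLeaves_tree)

theorem vertex_mem : PT.vertex ∈ multiplihedron m n :=
  shufflePoint_mem_shuffle _ (permutahedronVertex_mem _) (PTree.lodayVertex_mem_associahedron _)

theorem monotone_label_iff {x : Fin (m + n) → ℝ} :
    Monotone ((x ∘ Fin.castAdd n) ∘ PT.label) ↔
      ∀ a b, PT.Below (Fin.castAdd n a) (Fin.castAdd n b) →
        x (Fin.castAdd n a) ≤ x (Fin.castAdd n b) :=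
  ⟨fun h a b hab => by simpa using h (PT.below_cut_cut.1 hab),
    fun h _ _ hkl => h _ _ (PT.below_cut_cut.2 (by simpa using hkl))⟩

theorem normalCone_vertex : normalCone (multiplihedron m n) {PT.vertex} = PT.cone := by
  ext x
  rw [multiplihedron, vertex, mem_normalCone_shufflePoint _ (permutahedronVertex_mem _)
      (PTree.lodayVertex_mem_associahedron _), normalCone_permutahedron,
    PTree.normalCone_associahedron, Set.mem_ofPred_eq, monotone_label_iff, cone_eq]
  simp only [Set.mem_ofPred_eq, Fin.forall_fin_add, below_cut_node, below_node_cut,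
    below_node_node, forall_and]
  simp only [node]
  tauto

theorem isCorrespondingVertex_iff {w : Fin (m + n) → ℝ} :
    PT.IsCorrespondingVertex w ↔ w = PT.vertex := by
  have interior_nonempty := PT.normalCone_vertex.symm ▸ PT.interior_cone_nonempty
  constructor
  · rintro ⟨hw, hcone⟩
    exact eq_of_normalCone_eq PT.vertex_mem (exposedPoints_subset hw) interior_nonempty
      (hcone.trans PT.normalCone_vertex.symm)
  · rintro rfl
    exact ⟨mem_exposedPoints_of_interior_normalCone_nonempty PT.vertex_mem interior_nonempty,
      PT.normalCone_vertex⟩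

theorem vertex_castAdd (a : Fin m) :
    PT.vertex (Fin.castAdd n a) = (PT.numNodesBelowCut a : ℝ) + (PT.numCutsBelowCut a : ℝ) := by
  rw [vertex, shufflePoint_castAdd, numNodesBelowCut_eq, numCutsBelowCut_eq, permutahedronVertex,
    Nat.cast_succ, add_comm]

theorem vertex_natAdd (j : Fin n) :
    PT.vertex (Fin.natAdd m j) = (PT.numCutsBelowNode (PT.node j) : ℝ) +
      (PT.tree.leftLeaves (PT.node j) : ℝ) * (PT.tree.rightLeaves (PT.node j) : ℝ) := by
  rw [vertex, shufflePoint_natAdd, numCutsBelowNode_eq, add_comm]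
  rfl

theorem sum_vertex :
    ∑ i, PT.vertex i = ((m + 1).choose 2 : ℝ) + ((n + 1).choose 2 : ℝ) + (m : ℝ) * (n : ℝ) := by
  rw [vertex, sum_shufflePoint, sum_permutahedronVertex, PTree.sum_lodayVertex]

end BinaryPaintedTree

theorem mainTheorem7 (m n : ℕ) (PT : BinaryPaintedTree m n) :
    ∃ v : Fin (m + n) → ℝ,
      (∀ w : Fin (m + n) → ℝ, PT.IsCorrespondingVertex w ↔ w = v) ∧
      (∀ a : Fin m, v (Fin.castAdd n a) =
        (PT.numNodesBelowCut a : ℝ) + (PT.numCutsBelowCut a : ℝ)) ∧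
      (∀ j : Fin n, v (Fin.natAdd m j) =
        (PT.numCutsBelowNode (PT.node j) : ℝ) +
          (PT.tree.leftLeaves (PT.node j) : ℝ) * (PT.tree.rightLeaves (PT.node j) : ℝ)) ∧
      ∑ i, v i = ((m + 1).choose 2 : ℝ) + ((n + 1).choose 2 : ℝ) + (m : ℝ) * (n : ℝ) :=
  ⟨PT.vertex, fun _ => PT.isCorrespondingVertex_iff, PT.vertex_castAdd, PT.vertex_natAdd,
    PT.sum_vertex⟩
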